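/- Let $(\Omega,P)$ be a probability space carrying the following catalog model. Documents $d$, indexed by a countable set, arrive at random times $a_d$ which form a homogeneous Poisson point process of rate $\gamma\in[0,\infty)$ on $\mathbb{R}$. To each document is attached a random pair $(\lambda_d,\tau_d)$, where $\tau_d\in[0,\infty)$ is its lifespan and $\lambda_d:\mathbb{R}\to[0,\infty)$ is a measurable random function vanishing outside $[0,\tau_d]$ with $\int\lambda_d(u)\,\mathrm{d}u<\infty$ almost surely; the pairs are independent and identically distributed, and independent of the arrival times. Put $\Lambda_d(v)=\lambda_d(v-a_d)$, which vanishes outside $[a_d,a_d+\tau_d]$. Given all arrival times and all pairs, the request processes of the documents are independent Poisson point processes on $\mathbb{R}$, that of document $d$ having intensity function $\Lambda_d$. For $s\le t$ let $X^s_t\in\{0,1,2,\dots,\infty\}$ be the number of different documents that are requested at least once in $[s,t]$. Then, for every $s>0$, the processes $(X^s_t)_{t\ge s}$ and $(X^0_{t-s})_{t\ge s}$ have the same distribution. Furthermore, $(X^0_t)_{t\ge 0}$ is a Poisson process with mean function $\mathbb{E}[X^0_t]=\xi(t)$ given, for all $t\ge 0$, by \[ \xi(t)=\gamma\int_{-\infty}^{t}\mathbb{E}\Big[1-\exp\Big\{-\int_0^t\lambda(v-a)\,\mathrm{d}v\Big\}\Big]\mathrm{d}a\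 \in[0,\infty], \] where $\lambda$ has the common distribution of the $\lambda_d$ (that is, $\lambda(\cdot-a)$ is the intensity function of a document arriving at time $a$). Here a Poisson process with mean function $\xi$ means that, almost surely, $X^0_t$ is for all $t\ge0$ the number of points in $[0,t]$ of a Poisson point process on $[0,\infty)$ whose intensity measure gives mass $\xi(t)$ to $[0,t]$; if $\xi(t)=\infty$, the Poisson distribution with parameter $\xi(t)$ is the point mass at $\infty$. -/

import Mathlib

open MeasureTheory ProbabilityTheory
open scoped NNReal ENNReal

namespace CatalogModel

noncomputable section

/-- The Poisson distribution with parameter `r ∈ [0, ∞]`, as a measure on `[0, ∞]`;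
by the usual convention a Poisson variable with parameter `∞` is equal to `∞`. -/
def poissonLaw (r : ℝ≥0∞) : Measure ℝ≥0∞ :=
  if r = ∞ then Measure.dirac ∞
  else (poissonMeasure r.toNNReal).map (fun n : ℕ => (n : ℝ≥0∞))

/-- A point process on `S`: a random measure with values in `{0, 1, 2, …, ∞}`. -/
structure IsPointProcess {Ω S : Type*} [MeasurableSpace Ω] [MeasurableSpace S]
    (N : Ω → Measure S) : Prop where
  measurable : Measurable N
  integer_valued : ∀ ω B, MeasurableSet B → ∃ k : ℕ∞, N ω B = (k : ℝ≥0∞)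

/-- `N` is a Poisson point process on `S` with intensity measure `μ`: the numbers of points in
pairwise disjoint measurable sets are independent, and the number of points in `B` has the Poisson
distribution with parameter `μ B`. -/
structure IsPoissonPointProcess {Ω S : Type*} [MeasurableSpace Ω] [MeasurableSpace S]
    (N : Ω → Measure S) (μ : Measure S) (P : Measure Ω) : Prop where
  isPointProcess : IsPointProcess N
  hasLaw : ∀ B, MeasurableSet B → HasLaw (fun ω => N ω B) (poissonLaw (μ B)) P
  indep : ∀ (n : ℕ) (B : Fin n → Set S), (∀ i, MeasurableSet (B i)) →
    Pairwise (Function.onFun Disjoint B) → iIndepFun (fun i ω => N ω (B i)) P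

/-- `X` is a Poisson process on the half-line `[0, ∞)` with mean function `ξ`: almost surely,
`X t` is, for all `t ≥ 0` simultaneously, the number of points in `[0, t]` of a Poisson point
process whose intensity measure gives mass `ξ t` to `[0, t]`. -/
def IsPoissonProcess {Ω : Type*} [MeasurableSpace Ω]
    (X : ℝ≥0 → Ω → ℕ∞) (ξ : ℝ≥0 → ℝ≥0∞) (P : Measure Ω) : Prop :=
  ∃ (N : Ω → Measure ℝ≥0) (μ : Measure ℝ≥0),
    IsPoissonPointProcess N μ P ∧
    (∀ t : ℝ≥0, μ (Set.Iic t) = ξ t) ∧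
    ∀ᵐ ω ∂P, ∀ t : ℝ≥0, (X t ω : ℝ≥0∞) = N ω (Set.Iic t)

/-- A random document profile, with values `m` distributed according to `ν`: a lifespan `τ m`
together with a request intensity `lam m u` at age `u` (time elapsed since the arrival of the
document), which vanishes outside `[0, τ m]` and almost surely has a finite total mass. -/
structure IsRequestProfile {M : Type*} [MeasurableSpace M]
    (ν : Measure M) (lam : M → ℝ → ℝ≥0) (τ : M → ℝ≥0) : Prop where
  measurable_intensity : Measurable (Function.uncurry lam)
  measurable_lifespan : Measurable τ
  zero_outside_lifespan : ∀ m u, u ∉ Set.Icc (0 : ℝ) (τ m) → lam m u = 0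
  ae_finite_total : ∀ᵐ m ∂ν, ∫⁻ u, (lam m u : ℝ≥0∞) < ∞

/-- The intensity function `Λ_d` of document `d` on the time axis: the profile of `d`, translated
by its arrival time. It vanishes outside `[a_d, a_d + τ_d]`. -/
def docIntensity {Ω D M : Type*} (lam : M → ℝ → ℝ≥0) (arrival : D → Ω → ℝ) (mark : D → Ω → M)
    (d : D) (ω : Ω) (v : ℝ) : ℝ≥0 :=
  lam (mark d ω) (v - arrival d ω)

/-- The σ-algebra generated by the arrival times and the profiles of all documents. -/
abbrev catalogSigma {Ω D M : Type*} [MeasurableSpace M]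
    (arrival : D → Ω → ℝ) (mark : D → Ω → M) : MeasurableSpace Ω :=
  MeasurableSpace.comap (fun ω => ((fun d => arrival d ω), (fun d => mark d ω))) inferInstance

/-- The catalog and request model. Documents are indexed by `D`; document `d` has arrival time
`arrival d`, profile `mark d`, and request process `R d`. -/
structure IsCatalogModel {Ω D M : Type*} [MeasurableSpace Ω] [MeasurableSpace M]
    (γ : ℝ≥0) (ν : Measure M) (lam : M → ℝ → ℝ≥0)
    (arrival : D → Ω → ℝ) (mark : D → Ω → M) (R : D → Ω → Measure ℝ) (P : Measure Ω) : Prop where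
  measurable_arrival : ∀ d, Measurable (arrival d)
  measurable_mark : ∀ d, Measurable (mark d)
  /-- The catalog arrival process is a homogeneous Poisson process with rate `γ` on the line. -/
  arrival_poisson : IsPoissonPointProcess
    (fun ω => Measure.sum (fun d => Measure.dirac (arrival d ω))) ((γ : ℝ≥0∞) • volume) P
  /-- The profiles are identically distributed, -/
  mark_hasLaw : ∀ d, HasLaw (mark d) ν P
  /-- mutually independent, -/
  mark_indep : iIndepFun mark P
  /-- and independent of the arrival times. -/
  arrival_mark_indep : IndepFun (fun ω d => arrival d ω) (fun ω d => mark d ω) P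
  request_isPointProcess : ∀ d, IsPointProcess (R d)
  /-- Given all arrival times and profiles, the request processes of the documents are independent
  Poisson processes, that of `d` with intensity function `Λ_d`. -/
  request_cond_poisson : ∀ (F : Finset D) (n : ℕ) (B : D → Fin n → Set ℝ) (k : D → Fin n → ℕ),
    (∀ d i, MeasurableSet (B d i)) → (∀ d, Pairwise (Function.onFun Disjoint (B d))) →
    P[({ω | ∀ d ∈ F, ∀ i, R d ω (B d i) = (k d i : ℝ≥0∞)}).indicator (fun _ => (1 : ℝ)) |
        catalogSigma arrival mark] =ᵐ[P]
      fun ω => ∏ d ∈ F, ∏ i,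
        (poissonLaw (∫⁻ v in B d i, (docIntensity lam arrival mark d ω v : ℝ≥0∞))).real
          {(k d i : ℝ≥0∞)}

/-- `X^s_t`: the number of different documents requested in the time interval `[s, t]`. -/
def distinctRequested {Ω D : Type*} (R : D → Ω → Measure ℝ) (s t : ℝ) (ω : Ω) : ℕ∞ :=
  {d : D | R d ω (Set.Icc s t) ≠ 0}.encard

/-- `ξ(t) = γ ∫_{-∞}^t E[1 - exp(-∫_0^t Λ(v) dv)] da`, where `Λ` is the intensity function of
a document with arrival time `a` and a random profile with distribution `ν`. -/
def meanFunction {M : Type*} [MeasurableSpace M] (γ : ℝ≥0) (ν : Measure M) (lam : M → ℝ → ℝ≥0)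
    (t : ℝ≥0) : ℝ≥0∞ :=
  γ * ∫⁻ a in Set.Iic (t : ℝ), ∫⁻ m,
    ENNReal.ofReal (1 - Real.exp (-∫ v in (0 : ℝ)..t, (lam m (v - a) : ℝ))) ∂ν

end

end CatalogModel

/-! Let `T_d` be the time from `s` to the first request of document `d` at or after `s`, with `T_d =
∞` if there is none. Almost surely each request process is finite, so a first request is attained
and `X^s_{s+t}` counts the `d` with `T_d ≤ t`. Everything thus follows once the points `T_d` are
shown to have a Poisson Laplace functional that does not depend on `s`.

Given the catalog, the `T_d` are independent, and `T_d ≥ t` has probability `exp(-Λ_d[s, s+t))`.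
Hence they have the law of the times at which the cumulative intensities exceed independent standard
exponential levels (`map_requestTime_eq`). For measurable `φ ≥ 0` and `f = exp(-φ)`, averaging over
levels and profiles turns `E ∏ f(T_d)` into `E ∏ h(a_d)`, where `h(a)` is the mean of `f(T)` for a
document arriving at `a` (`lintegral_prod_requestTime`, `lintegral_prod_mark`). Writing `h =
exp(-ψ)`, this is the Laplace functional of the Poisson arrivals at `ψ`, namely `exp(-γ ∫ (1 - h))`.
Shifting `s` only translates `h`, and Lebesgue measure is invariant, so `s` drops out
(`lintegral_expNeg_requestTime`).

Laplace transforms determine laws on `[0, ∞]^n` (`ext_of_lintegral_expNeg`), so this formula gives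
both the Poisson property on finite times (`isPoissonPointProcess_of_lintegral_expNeg`) and the
stationarity of finite-dimensional distributions. Evaluating the intensity on `[0, t]` yields
`ξ(t)`. Counts and intensities may be infinite, so all transforms live on `[0, ∞]` with `exp(-∞) =
0`. -/

namespace CatalogModel

open Set Filter Topology

noncomputable section

/-! ### The exponential and the logarithm between `[0, ∞]` and `[0, 1]`. -/

section ExpNeg

/-- The function `x ↦ exp (-x)` from `[0, ∞]` to `[0, 1]`. -/
def expNeg (x : ℝ≥0∞) : ℝ≥0∞ := EReal.exp (-(x : EReal))

/-- The function `y ↦ -log y` on `[0, 1]`, an inverse of `expNeg`. -/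
def negLog (y : ℝ≥0∞) : ℝ≥0∞ := (-ENNReal.log y).toENNReal

@[simp] lemma expNeg_zero : expNeg 0 = 1 := by simp [expNeg]

@[simp] lemma expNeg_top : expNeg ∞ = 0 := by simp [expNeg]

lemma expNeg_coe (x : ℝ≥0) : expNeg x = ENNReal.ofReal (Real.exp (-x)) := by
  unfold expNeg
  rw [show ((x : ℝ≥0∞) : EReal) = ((x : ℝ) : EReal) from rfl, ← EReal.coe_neg, EReal.exp_coe]

lemma expNeg_of_ne_top {x : ℝ≥0∞} (hx : x ≠ ∞) :
    expNeg x = ENNReal.ofReal (Real.exp (-x.toReal)) := by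
  lift x to ℝ≥0 using hx
  rw [expNeg_coe, ENNReal.coe_toReal]

lemma expNeg_add (x y : ℝ≥0∞) : expNeg (x + y) = expNeg x * expNeg y := by
  unfold expNeg
  rw [← EReal.exp_add, EReal.coe_ennreal_add, EReal.neg_add, sub_eq_add_neg]
  · left; exact EReal.coe_ennreal_ne_bot x
  · right; exact EReal.coe_ennreal_ne_bot y

lemma expNeg_strictAnti : StrictAnti expNeg := fun x y h ↦ by
  simpa [expNeg] using h

lemma expNeg_le_one (x : ℝ≥0∞) : expNeg x ≤ 1 :=
  expNeg_zero ▸ expNeg_strictAnti.antitone (zero_le (a := x))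

lemma expNeg_ne_top (x : ℝ≥0∞) : expNeg x ≠ ∞ :=
  ((expNeg_le_one x).trans_lt ENNReal.one_lt_top).ne

@[fun_prop]
lemma continuous_expNeg : Continuous expNeg :=
  ENNReal.continuous_exp.comp (continuous_neg.comp continuous_coe_ennreal_ereal)

@[fun_prop]
lemma measurable_expNeg : Measurable expNeg := continuous_expNeg.measurable

@[fun_prop]
lemma measurable_negLog : Measurable negLog := by
  unfold negLog
  exact measurable_ereal_toENNReal.comp (measurable_neg.comp ENNReal.measurable_log)

lemma expNeg_negLog {y : ℝ≥0∞} (hy : y ≤ 1) : expNeg (negLog y) = y := by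
  unfold expNeg negLog
  rw [EReal.coe_toENNReal, neg_neg, ENNReal.exp_log]
  simpa using hy

lemma le_negLog_iff {x y : ℝ≥0∞} (hy : y ≤ 1) : x ≤ negLog y ↔ y ≤ expNeg x := by
  rw [← expNeg_strictAnti.le_iff_ge, expNeg_negLog hy]

lemma expNeg_sum {ι : Type*} (s : Finset ι) (f : ι → ℝ≥0∞) :
    expNeg (∑ i ∈ s, f i) = ∏ i ∈ s, expNeg (f i) := by
  classical
  induction s using Finset.induction_on with
  | empty => simp
  | insert i s hi ih => rw [Finset.sum_insert hi, Finset.prod_insert hi, expNeg_add, ih]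

lemma expNeg_nat_mul (n : ℕ) (x : ℝ≥0∞) : expNeg (n * x) = expNeg x ^ n := by
  induction n with
  | zero => simp
  | succ n ih => rw [Nat.cast_succ, add_mul, one_mul, expNeg_add, ih, pow_succ]

end ExpNeg

/-! ### Uniqueness of Laplace transforms on `[0, ∞]^ι`. -/

section LaplaceUniqueness

/-- A finite measure on `[0, ∞]^ι` is determined by its Laplace transform at the points
with natural coordinates. -/
theorem ext_of_lintegral_expNeg {ι : Type*} [Fintype ι] {μ ν : Measure (ι → ℝ≥0∞)}
    [IsFiniteMeasure μ] [IsFiniteMeasure ν]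
    (h : ∀ k : ι → ℕ, ∫⁻ x, expNeg (∑ i, k i * x i) ∂μ = ∫⁻ x, expNeg (∑ i, k i * x i) ∂ν) :
    μ = ν := by
  classical
  -- The functions `exp(-x_i)` generate an algebra of bounded continuous functions; it separates
  -- points, including those with infinite coordinates, because `expNeg` is injective on `[0, ∞]`.
  let e : ι → BoundedContinuousFunction (ι → ℝ≥0∞) ℝ := fun i ↦
    BoundedContinuousFunction.ofNormedAddCommGroup (fun x ↦ (expNeg (x i)).toReal)
      (by
        refine continuous_iff_continuousAt.2 fun x ↦ ?_
        exact (ENNReal.tendsto_toReal (expNeg_ne_top _)).comp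
          ((continuous_expNeg.comp (continuous_apply i)).tendsto x))
      1 (fun x ↦ by
        rw [Real.norm_of_nonneg ENNReal.toReal_nonneg]
        simpa using ENNReal.toReal_mono ENNReal.one_ne_top (expNeg_le_one (x i)))
  let A : StarSubalgebra ℝ (BoundedContinuousFunction (ι → ℝ≥0∞) ℝ) :=
    { Algebra.adjoin ℝ (range e) with
      star_mem' := fun {f} hf ↦ by
        have : star f = f := by ext x; simp
        rw [this]; exact hf }
  have hint (ρ : Measure (ι → ℝ≥0∞)) [IsFiniteMeasure ρ] (k : ι → ℕ) :
      ∫ x, (∏ i, e i ^ k i) x ∂ρ = (∫⁻ x, expNeg (∑ i, k i * x i) ∂ρ).toReal := by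
    have hm : Measurable fun x : ι → ℝ≥0∞ ↦ expNeg (∑ i, k i * x i) :=
      measurable_expNeg.comp (by fun_prop)
    rw [← integral_toReal hm.aemeasurable (ae_of_all _ fun x ↦ (expNeg_ne_top _).lt_top)]
    refine integral_congr_ae (ae_of_all _ fun x ↦ ?_)
    simp only [BoundedContinuousFunction.coe_prod, Finset.prod_apply,
      BoundedContinuousFunction.coe_pow, Pi.pow_apply, expNeg_sum, ENNReal.toReal_prod,
      expNeg_nat_mul, ENNReal.toReal_pow]
    rfl
  refine ext_of_forall_mem_subalgebra_integral_eq_of_polish (𝕜 := ℝ) (A := A) ?_ ?_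
  · intro x y hxy
    obtain ⟨i, hi⟩ := Function.ne_iff.1 hxy
    refine ⟨e i, ⟨e i, ⟨e i, Algebra.subset_adjoin (mem_range_self i), rfl⟩, rfl⟩, ?_⟩
    intro heq
    exact hi (expNeg_strictAnti.injective
      ((ENNReal.toReal_eq_toReal_iff' (expNeg_ne_top _) (expNeg_ne_top _)).1 heq))
  · intro g hg
    replace hg : g ∈ Subalgebra.toSubmodule (Algebra.adjoin ℝ (range e)) := hg
    rw [Algebra.adjoin_eq_span] at hg
    induction hg using Submodule.span_induction with
    | mem f hf =>
      -- The algebra is spanned by monomials in the `e i`, and the integral of the monomial with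
      -- exponents `k` is the Laplace transform at `k`.
      obtain ⟨k, rfl⟩ := Submonoid.mem_closure_range_iff_of_fintype.1 hf
      rw [hint, hint, h]
    | zero => simp
    | add f g _ _ hf hg =>
      simp only [BoundedContinuousFunction.coe_add, Pi.add_apply]
      rw [integral_add (f.integrable _) (g.integrable _),
        integral_add (f.integrable _) (g.integrable _), hf, hg]
    | smul c f _ hf =>
      simp only [BoundedContinuousFunction.coe_smul]
      rw [integral_smul, integral_smul, hf]

end LaplaceUniqueness

/-! ### Laplace transform, void probability and mean of the Poisson distribution. -/

section PoissonLaw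

instance isProbabilityMeasure_poissonLaw (r : ℝ≥0∞) : IsProbabilityMeasure (poissonLaw r) := by
  unfold poissonLaw
  split_ifs
  · infer_instance
  · exact Measure.isProbabilityMeasure_map (by fun_prop)

lemma lintegral_poissonLaw_coe (r : ℝ≥0) {f : ℝ≥0∞ → ℝ≥0∞} (hf : Measurable f) :
    ∫⁻ x, f x ∂poissonLaw r =
      ∑' n : ℕ, ENNReal.ofReal (Real.exp (-r) * r ^ n / n.factorial) * f n := by
  rw [poissonLaw, if_neg ENNReal.coe_ne_top, ENNReal.toNNReal_coe, lintegral_map hf (by fun_prop),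
    poissonMeasure, lintegral_sum_measure]
  simp

/-- The Laplace transform of the Poisson distribution. -/
lemma lintegral_expNeg_mul_poissonLaw (r c : ℝ≥0∞) :
    ∫⁻ x, expNeg (c * x) ∂poissonLaw r = expNeg ((1 - expNeg c) * r) := by
  rcases eq_or_ne r ∞ with rfl | hr
  · rw [poissonLaw, if_pos rfl, lintegral_dirac' _ (by fun_prop)]
    rcases eq_or_ne c 0 with rfl | hc
    · simp
    · have : expNeg c < 1 := expNeg_zero ▸ expNeg_strictAnti (pos_iff_ne_zero.2 hc)
      rw [ENNReal.mul_top hc, ENNReal.mul_top (tsub_pos_of_lt this).ne']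
  · lift r to ℝ≥0 using hr
    rw [lintegral_poissonLaw_coe r (by fun_prop)]
    have hz := expNeg_le_one c
    simp_rw [mul_comm c, expNeg_nat_mul]
    generalize expNeg c = z at hz
    lift z to ℝ≥0 using (hz.trans_lt ENNReal.one_lt_top).ne
    have hz' : z ≤ 1 := by exact_mod_cast hz
    have h1 : ((1 : ℝ≥0∞) - z) * r = (((1 - z) * r : ℝ≥0) : ℝ≥0∞) := by push_cast; rfl
    rw [h1, expNeg_coe]
    -- The exponential series at `r * z`, where `z` stands for `exp(-c)`.
    have hs : HasSum (fun n : ℕ ↦ Real.exp (-r) * r ^ n / n.factorial * (z : ℝ) ^ n)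
        (Real.exp (-((1 - z) * r : ℝ≥0))) := by
      have := (NormedSpace.expSeries_div_hasSum_exp ((r : ℝ) * z)).mul_left (Real.exp (-r))
      rw [← Real.exp_eq_exp_ℝ, ← Real.exp_add] at this
      convert! this using 1
      · ext n; rw [mul_pow]; ring
      · congr 1; push_cast [hz']; ring
    rw [← hs.tsum_eq, ENNReal.ofReal_tsum_of_nonneg (fun n ↦ by positivity) hs.summable]
    congr with n
    rw [ENNReal.ofReal_mul (by positivity), ENNReal.ofReal_pow (by positivity),
      ENNReal.ofReal_coe_nnreal]

/-- This is the Laplace transform at `c = ∞`: since `∞ * 0 = 0`, the function `expNeg (∞ * x)` is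
the indicator of `{0}`. -/
lemma poissonLaw_zero (r : ℝ≥0∞) : poissonLaw r {0} = expNeg r := by
  have h := lintegral_expNeg_mul_poissonLaw r ∞
  rw [expNeg_top, tsub_zero, one_mul] at h
  rw [← h, ← lintegral_indicator_one (measurableSet_singleton 0)]
  refine lintegral_congr fun x ↦ ?_
  rcases eq_or_ne x 0 with rfl | hx
  · simp
  · simp [hx, ENNReal.top_mul hx]

lemma tsum_poissonLaw_natCast {r : ℝ≥0∞} (hr : r ≠ ∞) :
    ∑' k : ℕ, poissonLaw r {(k : ℝ≥0∞)} = 1 := by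
  lift r to ℝ≥0 using hr
  have h := lintegral_poissonLaw_coe r (f := fun _ ↦ 1) measurable_const
  rw [lintegral_const, measure_univ] at h
  rw [← one_mul (1 : ℝ≥0∞), h]
  refine tsum_congr fun n ↦ ?_
  rw [poissonLaw, if_neg ENNReal.coe_ne_top, ENNReal.toNNReal_coe,
    Measure.map_apply (by fun_prop) (measurableSet_singleton _)]
  have : (fun n : ℕ ↦ (n : ℝ≥0∞)) ⁻¹' {(n : ℝ≥0∞)} = {n} := by ext m; simp
  rw [this, poissonMeasure_singleton, mul_one]

lemma lintegral_id_poissonLaw (r : ℝ≥0∞) : ∫⁻ x, x ∂poissonLaw r = r := by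
  rcases eq_or_ne r ∞ with rfl | hr
  · rw [poissonLaw, if_pos rfl, lintegral_dirac' ∞ (f := fun x ↦ x) measurable_id]
  · lift r to ℝ≥0 using hr
    rw [lintegral_poissonLaw_coe r (f := fun x ↦ x) measurable_id, tsum_eq_zero_add' ENNReal.summable]
    have h := lintegral_poissonLaw_coe r (f := fun _ ↦ 1) measurable_const
    rw [lintegral_const, measure_univ] at h
    simp only [Nat.cast_zero, mul_zero, zero_add]
    calc _ = ∑' n : ℕ, r * (ENNReal.ofReal (Real.exp (-r) * r ^ n / n.factorial) * 1) := by
          refine tsum_congr fun n ↦ ?_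
          rw [mul_one, ← ENNReal.ofReal_coe_nnreal (p := r), ← ENNReal.ofReal_mul (by positivity),
            ← ENNReal.ofReal_natCast, ← ENNReal.ofReal_mul (by positivity)]
          congr 1
          rw [Nat.factorial_succ]
          push_cast
          field_simp
          ring
      _ = r := by rw [ENNReal.tsum_mul_left, ← h]; simp

end PoissonLaw

lemma lintegral_pi_prod {ι : Type*} [Fintype ι] {X : ι → Type*} [∀ i, MeasurableSpace (X i)]
    (μ : ∀ i, Measure (X i)) [∀ i, IsProbabilityMeasure (μ i)] {g : ∀ i, X i → ℝ≥0∞}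
    (hg : ∀ i, Measurable (g i)) :
    ∫⁻ x, ∏ i, g i (x i) ∂Measure.pi μ = ∏ i, ∫⁻ x, g i x ∂μ i := by
  have hind : iIndepFun (fun i (x : ∀ i, X i) ↦ g i (x i)) (Measure.pi μ) :=
    iIndepFun_pi (X := g) fun i ↦ (hg i).aemeasurable
  rw [lintegral_prod_eq_prod_lintegral_of_indepFun _ _ hind
    fun i ↦ (hg i).comp (measurable_pi_apply i)]
  exact Finset.prod_congr rfl fun i _ ↦ (measurePreserving_eval μ i).lintegral_comp (hg i)

/-! ### Characterization of Poisson point processes by their Laplace functional. -/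

section LaplaceFunctional

variable {Ω S : Type*} [MeasurableSpace Ω] [MeasurableSpace S]
  {N : Ω → Measure S} {μ : Measure S} {P : Measure Ω}

/-- The fibres of `φ` are disjoint, so the counts on them are independent Poisson variables and the
expectation factorizes. -/
lemma IsPoissonPointProcess.lintegral_expNeg_simpleFunc (hN : IsPoissonPointProcess N μ P)
    (φ : SimpleFunc S ℝ≥0∞) :
    ∫⁻ ω, expNeg (∫⁻ x, φ x ∂N ω) ∂P = expNeg (∫⁻ x, (1 - expNeg (φ x)) ∂μ) := by
  let e := φ.range.equivFin.symm
  let B : Fin φ.range.card → Set S := fun i ↦ φ ⁻¹' {(e i : ℝ≥0∞)}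
  have hB (i) : MeasurableSet (B i) := φ.measurableSet_fiber _
  have hdisj : Pairwise (Function.onFun Disjoint B) := fun i j hij ↦
    Disjoint.preimage _ (disjoint_singleton.2 fun hc ↦ hij (e.injective (Subtype.ext hc)))
  have hsum (f : ℝ≥0∞ → ℝ≥0∞) :
      ∑ c ∈ φ.range, f c = ∑ i, f (e i) := by
    rw [← Finset.sum_coe_sort, ← e.sum_comp]
  have hint (ω) : ∫⁻ x, φ x ∂N ω = ∑ i, (e i : ℝ≥0∞) * N ω (B i) := by
    rw [SimpleFunc.lintegral_eq_lintegral, SimpleFunc.lintegral,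
      hsum (fun c ↦ c * N ω (φ ⁻¹' {c}))]
  have hμ : ∫⁻ x, (1 - expNeg (φ x)) ∂μ = ∑ i, (1 - expNeg (e i)) * μ (B i) := by
    have := SimpleFunc.lintegral_eq_lintegral (φ.map fun c ↦ 1 - expNeg c) μ
    simp only [SimpleFunc.coe_map, Function.comp_apply] at this
    rw [this, SimpleFunc.map_lintegral, hsum (fun c ↦ (1 - expNeg c) * μ (φ ⁻¹' {c}))]
  have hmeas (i) : Measurable fun x : ℝ≥0∞ ↦ expNeg ((e i : ℝ≥0∞) * x) :=
    measurable_expNeg.comp (by fun_prop)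
  simp_rw [hint, hμ, expNeg_sum]
  rw [lintegral_prod_eq_prod_lintegral_of_indepFun _
    (fun i ω ↦ expNeg ((e i : ℝ≥0∞) * N ω (B i)))
    ((hN.indep _ B hB hdisj).comp (fun i x ↦ expNeg ((e i : ℝ≥0∞) * x)) hmeas)
    fun i ↦ (hmeas i).comp ((Measure.measurable_coe (hB i)).comp hN.isPointProcess.measurable)]
  refine Finset.prod_congr rfl fun i _ ↦ ?_
  rw [(hN.hasLaw (B i) (hB i)).lintegral_comp (hmeas i).aemeasurable,
    lintegral_expNeg_mul_poissonLaw]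

/-- The Laplace functional of a Poisson point process. -/
theorem IsPoissonPointProcess.lintegral_expNeg [IsFiniteMeasure P]
    (hN : IsPoissonPointProcess N μ P) {φ : S → ℝ≥0∞} (hφ : Measurable φ) :
    ∫⁻ ω, expNeg (∫⁻ x, φ x ∂N ω) ∂P = expNeg (∫⁻ x, (1 - expNeg (φ x)) ∂μ) := by
  have hmono (x) : Monotone fun n ↦ SimpleFunc.eapprox φ n x := fun m n hmn ↦
    SimpleFunc.monotone_eapprox φ hmn x
  have hleft : Tendsto (fun n ↦ ∫⁻ ω, expNeg (∫⁻ x, SimpleFunc.eapprox φ n x ∂N ω) ∂P) atTop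
      (𝓝 (∫⁻ ω, expNeg (∫⁻ x, φ x ∂N ω) ∂P)) := by
    refine tendsto_lintegral_of_dominated_convergence (fun _ ↦ 1) (fun n ↦ ?_)
      (fun n ↦ ae_of_all _ fun ω ↦ expNeg_le_one _) (by simp) (ae_of_all _ fun ω ↦ ?_)
    · exact measurable_expNeg.comp ((Measure.measurable_lintegral
        (SimpleFunc.measurable _)).comp hN.isPointProcess.measurable)
    · refine (continuous_expNeg.tendsto _).comp ?_
      exact lintegral_tendsto_of_tendsto_of_monotone (fun n ↦ (SimpleFunc.measurable _).aemeasurable)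
        (ae_of_all _ hmono) (ae_of_all _ fun x ↦ SimpleFunc.tendsto_eapprox hφ x)
  have hright : Tendsto (fun n ↦ expNeg (∫⁻ x, (1 - expNeg (SimpleFunc.eapprox φ n x)) ∂μ)) atTop
      (𝓝 (expNeg (∫⁻ x, (1 - expNeg (φ x)) ∂μ))) := by
    refine (continuous_expNeg.tendsto _).comp ?_
    refine lintegral_tendsto_of_tendsto_of_monotone (fun n ↦ ?_)
      (ae_of_all _ fun x m n hmn ↦ ?_) (ae_of_all _ fun x ↦ ?_)
    · exact (measurable_const.sub
        (measurable_expNeg.comp (SimpleFunc.measurable _))).aemeasurable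
    · exact tsub_le_tsub_left (expNeg_strictAnti.antitone (hmono x hmn)) _
    · exact ENNReal.Tendsto.sub tendsto_const_nhds
        ((continuous_expNeg.tendsto _).comp (SimpleFunc.tendsto_eapprox hφ x))
        (Or.inl ENNReal.one_ne_top)
  simp_rw [hN.lintegral_expNeg_simpleFunc] at hleft
  exact tendsto_nhds_unique hleft hright

/-- A point process whose counts have the Laplace transform of a Poisson process with intensity `μ`
is a Poisson process with intensity `μ`. -/
theorem isPoissonPointProcess_of_lintegral_expNeg [IsProbabilityMeasure P] (hN : IsPointProcess N)
    (h : ∀ φ : S → ℝ≥0∞, Measurable φ →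
      ∫⁻ ω, expNeg (∫⁻ x, φ x ∂N ω) ∂P = expNeg (∫⁻ x, (1 - expNeg (φ x)) ∂μ)) :
    IsPoissonPointProcess N μ P := by
  have hmeas {B : Set S} (hB : MeasurableSet B) : Measurable fun ω ↦ N ω B :=
    (Measure.measurable_coe hB).comp hN.measurable
  have key {n : ℕ} (B : Fin n → Set S) (hB : ∀ i, MeasurableSet (B i))
      (hdisj : Pairwise (Function.onFun Disjoint B)) :
      P.map (fun ω i ↦ N ω (B i)) = Measure.pi fun i ↦ poissonLaw (μ (B i)) := by
    have hmB : Measurable fun ω i ↦ N ω (B i) := measurable_pi_lambda _ fun i ↦ hmeas (hB i)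
    have := Measure.isProbabilityMeasure_map (μ := P) hmB.aemeasurable
    refine ext_of_lintegral_expNeg fun k ↦ ?_
    have hm : Measurable fun x : Fin n → ℝ≥0∞ ↦ expNeg (∑ i, k i * x i) :=
      measurable_expNeg.comp (by fun_prop)
    have hmi (i) : Measurable fun x : ℝ≥0∞ ↦ expNeg (k i * x) :=
      measurable_expNeg.comp (by fun_prop)
    let φ : S → ℝ≥0∞ := fun x ↦ ∑ i, (B i).indicator (fun _ ↦ (k i : ℝ≥0∞)) x
    have hφ : Measurable φ :=
      Finset.measurable_sum _ fun i _ ↦ measurable_const.indicator (hB i)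
    have hint (ω) : ∫⁻ x, φ x ∂N ω = ∑ i, k i * N ω (B i) := by
      rw [lintegral_finsetSum _ fun i _ ↦ measurable_const.indicator (hB i)]
      simp [lintegral_indicator (hB _)]
    have hintμ : ∫⁻ x, (1 - expNeg (φ x)) ∂μ = ∑ i, (1 - expNeg (k i)) * μ (B i) := by
      -- By disjointness at most one term of `φ x` is nonzero, so `1 - exp(-·)` may be applied
      -- termwise.
      have hx (x : S) : 1 - expNeg (φ x) = ∑ i, (B i).indicator (fun _ ↦ 1 - expNeg (k i)) x := by
        by_cases hx : ∃ i, x ∈ B i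
        · obtain ⟨i, hi⟩ := hx
          have hj (j) (hji : j ≠ i) : x ∉ B j := fun hj ↦
            (disjoint_left.1 (hdisj hji)) hj hi
          simp only [φ]
          rw [Finset.sum_eq_single i, Finset.sum_eq_single i, indicator_of_mem hi,
            indicator_of_mem hi] <;> simp +contextual [hj]
        · push Not at hx
          simp [φ, hx]
      simp_rw [hx]
      rw [lintegral_finsetSum _ fun i _ ↦ measurable_const.indicator (hB i)]
      simp [lintegral_indicator (hB _)]
    rw [lintegral_map hm hmB]
    simp_rw [← hint]
    rw [h φ hφ, hintμ]
    simp_rw [expNeg_sum]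
    rw [lintegral_pi_prod _ hmi]
    simp_rw [lintegral_expNeg_mul_poissonLaw]
  have hlaw (B : Set S) (hB : MeasurableSet B) :
      HasLaw (fun ω ↦ N ω B) (poissonLaw (μ B)) P := by
    refine ⟨(hmeas hB).aemeasurable, ?_⟩
    have := congrArg (Measure.map (Function.eval (0 : Fin 1)))
      (key (fun _ : Fin 1 ↦ B) (fun _ ↦ hB) (fun i j hij ↦ (hij (Subsingleton.elim i j)).elim))
    rwa [Measure.map_map (measurable_pi_apply _) (measurable_pi_lambda _ fun i ↦ hmeas hB),
      (measurePreserving_eval (fun _ : Fin 1 ↦ poissonLaw (μ B)) 0).map_eq] at this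
  refine ⟨hN, hlaw, fun n B hB hdisj ↦ ?_⟩
  rw [iIndepFun_iff_map_fun_eq_pi_map fun i ↦ (hmeas (hB i)).aemeasurable, key B hB hdisj]
  congr with i : 1
  exact (hlaw _ (hB i)).map_eq.symm

end LaplaceFunctional

/-! ### First passage times of cumulative masses, and exponential levels. -/

section Threshold

/-- The time window `[s, s + t)`, where `t ∈ [0, ∞]`. -/
def window (s : ℝ) (t : ℝ≥0∞) : Set ℝ := {v | s ≤ v ∧ ENNReal.ofReal (v - s) < t}

@[measurability]
lemma measurableSet_window (s : ℝ) (t : ℝ≥0∞) : MeasurableSet (window s t) :=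
  measurableSet_Ici.inter
    (measurableSet_lt (f := fun v ↦ ENNReal.ofReal (v - s)) (by fun_prop) measurable_const)

lemma window_mono (s : ℝ) : Monotone (window s) := fun _ _ h _ hv ↦ ⟨hv.1, hv.2.trans_le h⟩

@[simp] lemma window_zero (s : ℝ) : window s 0 = ∅ := by ext; simp [window]

lemma iUnion_window_of_tendsto (s : ℝ) {u : ℕ → ℝ≥0∞} {t : ℝ≥0∞} (hu : ∀ n, u n ≤ t)
    (h : Tendsto u atTop (𝓝 t)) : ⋃ n, window s (u n) = window s t := by
  refine subset_antisymm (iUnion_subset fun n ↦ window_mono s (hu n)) fun v hv ↦ ?_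
  obtain ⟨n, hn⟩ := (h.eventually_const_lt hv.2).exists
  exact mem_iUnion.2 ⟨n, hv.1, hn⟩

lemma iInter_window (s : ℝ) (t : ℝ≥0) :
    ⋂ n : ℕ, window s (t + ((n : ℝ≥0∞) + 1)⁻¹) = Icc s (s + t) := by
  ext v
  simp only [window, mem_iInter, mem_ofPred_eq, mem_Icc]
  have hiff : v ≤ s + t ↔ ENNReal.ofReal (v - s) ≤ t := by
    rw [ENNReal.ofReal_le_iff_le_toReal ENNReal.coe_ne_top, ENNReal.coe_toReal]
    constructor <;> intro <;> linarith
  rw [hiff]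
  refine ⟨fun h ↦ ⟨(h 0).1, ?_⟩, fun h n ↦ ⟨h.1, h.2.trans_lt ?_⟩⟩
  · have hlim : Tendsto (fun n : ℕ ↦ (t : ℝ≥0∞) + ((n : ℝ≥0∞) + 1)⁻¹) atTop (𝓝 (t + 0)) := by
      refine tendsto_const_nhds.add ?_
      have := (tendsto_add_atTop_iff_nat 1).2 ENNReal.tendsto_inv_nat_nhds_zero
      simpa using this
    rw [add_zero] at hlim
    exact ge_of_tendsto' hlim fun n ↦ (h n).2.le
  · exact ENNReal.lt_add_right ENNReal.coe_ne_top (by simp)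

/-- The first time `t` after `s` at which the mass of `[s, s + t]` exceeds the level `c`. -/
def threshold (μ : Measure ℝ) (s : ℝ) (c : ℝ≥0∞) : ℝ≥0∞ := sSup {t | μ (window s t) ≤ c}

/-- Half-open windows are continuous along increasing limits of `t`, so the supremum defining
`threshold` is attained; no finiteness of `μ` is needed. -/
lemma le_threshold_iff {μ : Measure ℝ} {s : ℝ} {c t : ℝ≥0∞} :
    t ≤ threshold μ s c ↔ μ (window s t) ≤ c := by
  refine ⟨fun h ↦ ?_, fun h ↦ le_sSup h⟩
  refine (measure_mono (window_mono s h)).trans ?_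
  obtain ⟨u, hu, hlim, hmem⟩ := exists_seq_tendsto_sSup (S := {t | μ (window s t) ≤ c})
    ⟨0, by simp⟩ (OrderTop.bddAbove _)
  rw [threshold, ← iUnion_window_of_tendsto s (fun n ↦ le_sSup (hmem n)) hlim,
    (show Monotone fun n ↦ window s (u n) from fun m n hmn ↦
      window_mono s (hu hmn)).measure_iUnion]
  exact iSup_le hmem

lemma antitone_measure_window (μ : Measure ℝ) (s : ℝ) (t : ℝ≥0) :
    Antitone fun n : ℕ ↦ μ (window s (t + ((n : ℝ≥0∞) + 1)⁻¹)) := fun m n hmn ↦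
  measure_mono (window_mono s (by gcongr))

lemma tendsto_measure_window (μ : Measure ℝ) [IsFiniteMeasure μ] (s : ℝ) (t : ℝ≥0) :
    Tendsto (fun n : ℕ ↦ μ (window s (t + ((n : ℝ≥0∞) + 1)⁻¹))) atTop
      (𝓝 (μ (Icc s (s + t)))) := by
  rw [← iInter_window]
  exact tendsto_measure_iInter_atTop (fun n ↦ (measurableSet_window _ _).nullMeasurableSet)
    (fun m n hmn ↦ window_mono s (by gcongr)) ⟨0, measure_ne_top _ _⟩

lemma lt_threshold_iff {μ : Measure ℝ} {s : ℝ} {c : ℝ≥0∞} {t : ℝ≥0} :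
    t < threshold μ s c ↔ ∃ n : ℕ, μ (window s (t + ((n : ℝ≥0∞) + 1)⁻¹)) ≤ c := by
  simp_rw [← le_threshold_iff]
  refine ⟨fun h ↦ ?_, fun ⟨n, hn⟩ ↦
    (ENNReal.lt_add_right ENNReal.coe_ne_top (by simp)).trans_le hn⟩
  obtain ⟨n, hn⟩ := ENNReal.exists_inv_nat_lt (tsub_pos_of_lt h).ne'
  refine ⟨n, ?_⟩
  calc (t : ℝ≥0∞) + ((n : ℝ≥0∞) + 1)⁻¹ ≤ t + (threshold μ s c - t) := by
        gcongr
        exact (ENNReal.inv_le_inv.2 le_self_add).trans hn.le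
    _ = threshold μ s c := add_tsub_cancel_of_le h.le

/-- The first point after `s` of a finite integer-valued measure is attained. -/
lemma threshold_zero_le_iff {μ : Measure ℝ} [IsFiniteMeasure μ]
    (hμ : ∀ B, MeasurableSet B → ∃ k : ℕ∞, μ B = (k : ℝ≥0∞)) (s : ℝ) (t : ℝ≥0) :
    threshold μ s 0 ≤ t ↔ μ (Icc s (s + t)) ≠ 0 := by
  rw [← not_lt, not_iff_not, lt_threshold_iff]
  constructor
  · rintro ⟨n, hn⟩
    refine measure_mono_null ?_ (le_zero_iff.1 hn)
    rw [← iInter_window]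
    exact iInter_subset _ n
  · intro h
    have hlim := tendsto_measure_window μ s t
    rw [h] at hlim
    -- An integer mass below `1` is `0`, so some window slightly longer than `[s, s + t]` is free of
    -- points.
    obtain ⟨n, hn⟩ := (hlim.eventually_lt_const zero_lt_one).exists
    obtain ⟨k, hk⟩ := hμ _ (measurableSet_window s (t + ((n : ℝ≥0∞) + 1)⁻¹))
    refine ⟨n, ?_⟩
    rw [hk] at hn ⊢
    have hk1 : k < 1 := by exact_mod_cast hn
    simp [Order.lt_one_iff.1 hk1]

lemma measurable_threshold {X : Type*} [MeasurableSpace X] {κ : X → Measure ℝ} (s : ℝ)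
    (hκ : ∀ t, Measurable fun x ↦ κ x (window s t)) :
    Measurable fun p : X × ℝ≥0∞ ↦ threshold (κ p.1) s p.2 := by
  refine measurable_of_Ici fun t ↦ ?_
  have : (fun p : X × ℝ≥0∞ ↦ threshold (κ p.1) s p.2) ⁻¹' Ici t =
      {p | κ p.1 (window s t) ≤ p.2} := by
    ext p; exact le_threshold_iff
  rw [this]
  exact measurableSet_le ((hκ t).comp measurable_fst) measurable_snd

lemma measurable_threshold_level (μ : Measure ℝ) (s : ℝ) : Measurable (threshold μ s) :=
  Monotone.measurable fun _ _ h ↦ sSup_le_sSup fun _ ht ↦ le_trans ht h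

/-- The standard exponential distribution, as a measure on `[0, ∞]`. -/
def expLaw : Measure ℝ≥0∞ :=
  (volume : Measure unitInterval).map fun u : unitInterval ↦ negLog (ENNReal.ofReal (u : ℝ))

lemma measurable_negLog_unitInterval :
    Measurable fun u : unitInterval ↦ negLog (ENNReal.ofReal u) :=
  measurable_negLog.comp (ENNReal.measurable_ofReal.comp measurable_subtype_coe)

instance : IsProbabilityMeasure expLaw :=
  Measure.isProbabilityMeasure_map measurable_negLog_unitInterval.aemeasurable

lemma expLaw_Ici (h : ℝ≥0∞) : expLaw (Ici h) = expNeg h := by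
  have hle : (expNeg h).toReal ≤ 1 := by
    simpa using ENNReal.toReal_mono ENNReal.one_ne_top (expNeg_le_one h)
  have hset : (fun u : unitInterval ↦ negLog (ENNReal.ofReal u)) ⁻¹' Ici h =
      Iic ⟨(expNeg h).toReal, ENNReal.toReal_nonneg, hle⟩ := by
    ext u
    rw [mem_preimage, mem_Ici, le_negLog_iff (ENNReal.ofReal_le_one.2 u.2.2),
      ENNReal.ofReal_le_iff_le_toReal (expNeg_ne_top _), mem_Iic, ← Subtype.coe_le_coe]
  rw [expLaw, Measure.map_apply measurable_negLog_unitInterval measurableSet_Ici, hset,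
    unitInterval.volume_Iic, ENNReal.ofReal_toReal (expNeg_ne_top _)]

/-- The complementary event is the increasing union of `{e ≥ μ (window s (t + 1/(n+1)))}`. These
windows shrink to `[s, s + t]`, and finiteness of `μ` gives convergence of their masses. -/
lemma expLaw_threshold_le (μ : Measure ℝ) [IsFiniteMeasure μ] (s : ℝ) (t : ℝ≥0) :
    expLaw {e | threshold μ s e ≤ t} = 1 - expNeg (μ (Icc s (s + t))) := by
  have hset : {e | threshold μ s e ≤ t} =
      (⋃ n : ℕ, Ici (μ (window s (t + ((n : ℝ≥0∞) + 1)⁻¹))))ᶜ := by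
    ext e
    simp only [mem_ofPred_eq, mem_compl_iff, mem_iUnion, mem_Ici, ← lt_threshold_iff, not_lt]
  rw [hset, prob_compl_eq_one_sub (MeasurableSet.iUnion fun n ↦ measurableSet_Ici)]
  congr 1
  have hlim := tendsto_measure_iUnion_atTop (μ := expLaw)
    (s := fun n : ℕ ↦ Ici (μ (window s (t + ((n : ℝ≥0∞) + 1)⁻¹))))
    fun m n hmn ↦ Ici_subset_Ici.2 (antitone_measure_window μ s t hmn)
  refine tendsto_nhds_unique hlim ?_
  simp only [Function.comp_def, expLaw_Ici]
  exact (continuous_expNeg.tendsto _).comp (tendsto_measure_window μ s t)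

end Threshold

section PoissonLaw

@[fun_prop]
lemma measurable_poissonLaw_singleton (k : ℕ) :
    Measurable fun r ↦ poissonLaw r {(k : ℝ≥0∞)} := by
  have : (fun r ↦ poissonLaw r {(k : ℝ≥0∞)}) = fun r ↦ if r = ∞ then 0 else
      ENNReal.ofReal (Real.exp (-r.toNNReal) * r.toNNReal ^ k / k.factorial) := by
    ext r
    split_ifs with hr
    · simp [poissonLaw, hr]
    · rw [poissonLaw, if_neg hr, Measure.map_apply (by fun_prop) (measurableSet_singleton _)]
      have : (fun n : ℕ ↦ (n : ℝ≥0∞)) ⁻¹' {(k : ℝ≥0∞)} = {k} := by ext m; simp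
      rw [this, poissonMeasure_singleton]
  rw [this]
  exact Measurable.ite (measurableSet_singleton _) measurable_const (by fun_prop)

end PoissonLaw

/-! ### Request times given the catalog. -/

section Model

/-- The intensity measure of the requests for a document with arrival time `a` and profile `m`. -/
def docMeasure {M : Type*} (lam : M → ℝ → ℝ≥0) (p : ℝ × M) : Measure ℝ :=
  volume.withDensity fun v ↦ (lam p.2 (v - p.1) : ℝ≥0∞)

/-- The time between `s` and the first request from `s` on of document `d`. -/
def requestTime {Ω D : Type*} (R : D → Ω → Measure ℝ) (s : ℝ) (d : D) (ω : Ω) : ℝ≥0∞ :=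
  threshold (R d ω) s 0

/-- The conditional expectation of `f T`, where `T` is the time between `s` and the first request
from `s` on of a document with arrival time `a` and profile `m`. -/
def requestMean {M : Type*} (lam : M → ℝ → ℝ≥0) (s : ℝ) (f : ℝ≥0∞ → ℝ≥0∞) (p : ℝ × M) : ℝ≥0∞ :=
  ∫⁻ e, f (threshold (docMeasure lam p) s e) ∂expLaw

lemma docMeasure_univ {M : Type*} (lam : M → ℝ → ℝ≥0) (p : ℝ × M) :
    docMeasure lam p univ = ∫⁻ u, (lam p.2 u : ℝ≥0∞) := by
  rw [docMeasure, withDensity_apply _ MeasurableSet.univ, Measure.restrict_univ,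
    lintegral_sub_right_eq_self (fun u ↦ (lam p.2 u : ℝ≥0∞))]

/-- Delaying the observation by `s` has the same effect as advancing the arrival by `s`; this is the
source of stationarity. -/
lemma docMeasure_window_shift {M : Type*} (lam : M → ℝ → ℝ≥0) (s a : ℝ) (m : M) (t : ℝ≥0∞) :
    docMeasure lam (a, m) (window s t) = docMeasure lam (a - s, m) (window 0 t) := by
  rw [docMeasure, docMeasure, withDensity_apply _ (measurableSet_window _ _),
    withDensity_apply _ (measurableSet_window _ _), ← lintegral_indicator (measurableSet_window _ _),
    ← lintegral_indicator (measurableSet_window _ _),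
    ← lintegral_sub_right_eq_self (indicator (window 0 t) _) s]
  refine lintegral_congr fun v ↦ ?_
  have : v - s ∈ window 0 t ↔ v ∈ window s t := by simp [window]
  by_cases hv : v ∈ window s t
  · rw [indicator_of_mem hv, indicator_of_mem (this.2 hv)]
    simp
  · rw [indicator_of_notMem hv, indicator_of_notMem (mt this.1 hv)]

lemma requestMean_shift {M : Type*} (lam : M → ℝ → ℝ≥0) (s a : ℝ) (m : M) (f : ℝ≥0∞ → ℝ≥0∞) :
    requestMean lam s f (a, m) = requestMean lam 0 f (a - s, m) := by
  simp only [requestMean, threshold, docMeasure_window_shift lam s]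

lemma setLIntegral_docIntensity {Ω D M : Type*} (lam : M → ℝ → ℝ≥0) (arrival : D → Ω → ℝ) (mark : D → Ω → M)
    (d : D) (ω : Ω) {B : Set ℝ} (hB : MeasurableSet B) :
    ∫⁻ v in B, (docIntensity lam arrival mark d ω v : ℝ≥0∞) =
      docMeasure lam (arrival d ω, mark d ω) B := by
  rw [docMeasure, withDensity_apply _ hB]
  rfl

variable {Ω D M : Type*} [MeasurableSpace Ω] [MeasurableSpace M]
  {P : Measure Ω} {ν : Measure M} {γ : ℝ≥0} {lam : M → ℝ → ℝ≥0} {τ : M → ℝ≥0}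
  {arrival : D → Ω → ℝ} {mark : D → Ω → M} {R : D → Ω → Measure ℝ}

lemma measurable_docMeasure (hlam : Measurable (Function.uncurry lam)) {B : Set ℝ}
    (hB : MeasurableSet B) : Measurable fun p : ℝ × M ↦ docMeasure lam p B := by
  unfold docMeasure
  simp_rw [withDensity_apply _ hB]
  refine Measurable.lintegral_prod_right (f := fun (p : ℝ × M) v ↦ (lam p.2 (v - p.1) : ℝ≥0∞)) ?_
  exact (hlam.comp ((measurable_snd.comp measurable_fst).prodMk
    (measurable_snd.sub (measurable_fst.comp measurable_fst)))).coe_nnreal_ennreal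

lemma measurable_threshold_docMeasure (hlam : Measurable (Function.uncurry lam)) (s : ℝ) :
    Measurable fun q : (ℝ × M) × ℝ≥0∞ ↦ threshold (docMeasure lam q.1) s q.2 :=
  measurable_threshold s fun _ ↦ measurable_docMeasure hlam (measurableSet_window _ _)

lemma measurable_requestMean (hlam : Measurable (Function.uncurry lam)) (s : ℝ)
    {f : ℝ≥0∞ → ℝ≥0∞} (hf : Measurable f) : Measurable (requestMean lam s f) :=
  Measurable.lintegral_prod_right (hf.comp (measurable_threshold_docMeasure hlam s))

lemma measurable_requestTime (hR : ∀ d, Measurable (R d)) (s : ℝ) (d : D) :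
    Measurable (requestTime R s d) := by
  have := measurable_threshold (κ := R d) s fun t ↦
    (Measure.measurable_coe (measurableSet_window s t)).comp (hR d)
  exact this.comp (measurable_id.prodMk measurable_const)

lemma catalogSigma_le (hmodel : IsCatalogModel γ ν lam arrival mark R P) :
    catalogSigma arrival mark ≤ (inferInstance : MeasurableSpace Ω) :=
  ((measurable_pi_lambda _ hmodel.measurable_arrival).prodMk
    (measurable_pi_lambda _ hmodel.measurable_mark)).comap_le

variable [IsProbabilityMeasure P]

/-- The joint distribution of the numbers of requests of finitely many documents in one set each. -/
lemma measure_counts_eq (hlam : Measurable (Function.uncurry lam))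
    (hmodel : IsCatalogModel γ ν lam arrival mark R P)
    (F : Finset D) {B : D → Set ℝ} (hB : ∀ d, MeasurableSet (B d)) (k : D → ℕ) :
    P {ω | ∀ d ∈ F, R d ω (B d) = k d} =
      ∫⁻ ω, ∏ d ∈ F,
        poissonLaw (docMeasure lam (arrival d ω, mark d ω) (B d)) {(k d : ℝ≥0∞)} ∂P := by
  have hcond := hmodel.request_cond_poisson F 1 (fun d _ ↦ B d) (fun d _ ↦ k d) (fun d _ ↦ hB d)
    fun d i j hij ↦ (hij (Subsingleton.elim i j)).elim
  have hset : {ω | ∀ d ∈ F, ∀ _ : Fin 1, R d ω (B d) = k d} =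
      {ω | ∀ d ∈ F, R d ω (B d) = k d} := by
    ext ω; simp
  simp only [Fin.prod_univ_one, setLIntegral_docIntensity lam arrival mark _ _ (hB _)] at hcond
  rw [hset] at hcond
  have hmeas : MeasurableSet {ω | ∀ d ∈ F, R d ω (B d) = k d} := by
    have : {ω | ∀ d ∈ F, R d ω (B d) = k d} = ⋂ d ∈ F, {ω | R d ω (B d) = k d} := by
      ext ω; simp
    rw [this]
    refine Finset.measurableSet_biInter _ fun d _ ↦ ?_
    exact (Measure.measurable_coe (hB d)).comp (hmodel.request_isPointProcess d).measurable
      (measurableSet_singleton _)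
  have hint := integral_condExp (catalogSigma_le hmodel) (μ := P)
    (f := {ω | ∀ d ∈ F, R d ω (B d) = k d}.indicator fun _ ↦ (1 : ℝ))
  rw [integral_congr_ae hcond, integral_indicator_const _ hmeas, smul_eq_mul, mul_one] at hint
  have hfin (ω : Ω) : ∏ d ∈ F,
      poissonLaw (docMeasure lam (arrival d ω, mark d ω) (B d)) {(k d : ℝ≥0∞)} ≤ 1 :=
    Finset.prod_le_one (fun _ _ ↦ zero_le) fun _ _ ↦ prob_le_one
  have hm : Measurable fun ω ↦ ∏ d ∈ F,
      poissonLaw (docMeasure lam (arrival d ω, mark d ω) (B d)) {(k d : ℝ≥0∞)} :=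
    Finset.measurable_prod _ fun d _ ↦ (measurable_poissonLaw_singleton (k d)).comp
      ((measurable_docMeasure hlam (hB d)).comp
        ((hmodel.measurable_arrival d).prodMk (hmodel.measurable_mark d)))
  simp only [measureReal_def, ← ENNReal.toReal_prod] at hint
  rw [integral_toReal hm.aemeasurable
    (ae_of_all _ fun ω ↦ (hfin ω).trans_lt ENNReal.one_lt_top)] at hint
  have hne : ∫⁻ ω, ∏ d ∈ F,
      poissonLaw (docMeasure lam (arrival d ω, mark d ω) (B d)) {(k d : ℝ≥0∞)} ∂P ≠ ∞ :=
    ((lintegral_mono hfin).trans_lt (by simp)).ne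
  exact ((ENNReal.toReal_eq_toReal_iff' hne (measure_ne_top _ _)).1 hint).symm

/-- Almost surely, each document is requested finitely many times. -/
lemma ae_isFiniteMeasure_request [Countable D] (hprofile : IsRequestProfile ν lam τ)
    (hmodel : IsCatalogModel γ ν lam arrival mark R P) :
    ∀ᵐ ω ∂P, ∀ d, IsFiniteMeasure (R d ω) := by
  refine ae_all_iff.2 fun d ↦ ?_
  have hlam := hprofile.measurable_intensity
  have hint : ∀ᵐ ω ∂P, docMeasure lam (arrival d ω, mark d ω) univ < ∞ := by
    have hmeas : Measurable fun m ↦ ∫⁻ u, (lam m u : ℝ≥0∞) :=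
      Measurable.lintegral_prod_right (f := fun m u ↦ (lam m u : ℝ≥0∞)) hlam.coe_nnreal_ennreal
    have := ((hmodel.mark_hasLaw d).ae_iff
      (measurableSet_setOfPred.1 (measurableSet_lt hmeas measurable_const))).2
        hprofile.ae_finite_total
    simpa only [docMeasure_univ] using this
  have hmeasR : Measurable fun ω ↦ R d ω univ :=
    (Measure.measurable_coe MeasurableSet.univ).comp (hmodel.request_isPointProcess d).measurable
  have hk (k : ℕ) := measure_counts_eq hlam hmodel {d} (fun _ ↦ MeasurableSet.univ) fun _ ↦ k
  simp only [Finset.mem_singleton, forall_eq, Finset.prod_singleton] at hk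
  -- The total count is conditionally Poisson with almost surely finite parameter, so the
  -- probabilities of the finite values sum to `1`.
  have hone : P (⋃ k : ℕ, {ω | R d ω univ = k}) = 1 := by
    rw [measure_iUnion]
    · simp_rw [hk]
      have hm (k : ℕ) : Measurable fun ω ↦
          poissonLaw (docMeasure lam (arrival d ω, mark d ω) univ) {(k : ℝ≥0∞)} :=
        (measurable_poissonLaw_singleton k).comp ((measurable_docMeasure hlam MeasurableSet.univ).comp
          ((hmodel.measurable_arrival d).prodMk (hmodel.measurable_mark d)))
      rw [← lintegral_tsum fun k ↦ (hm k).aemeasurable, lintegral_congr_ae (g := fun _ ↦ 1)]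
      · simp
      · filter_upwards [hint] with ω hω using tsum_poissonLaw_natCast hω.ne
    · intro i j hij
      refine disjoint_left.2 fun ω hi hj ↦ hij ?_
      have : (i : ℝ≥0∞) = j := hi.symm.trans hj
      exact_mod_cast this
    · exact fun k ↦ hmeasR (measurableSet_singleton _)
  have hae := (prob_compl_eq_zero_iff
    (MeasurableSet.iUnion fun k : ℕ ↦ hmeasR (measurableSet_singleton (k : ℝ≥0∞)))).2 hone
  filter_upwards [compl_mem_ae_iff.2 hae] with ω hω
  obtain ⟨k, hk⟩ := mem_iUnion.1 (not_notMem.1 hω)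
  have hk' : R d ω univ = k := hk
  exact ⟨hk' ▸ ENNReal.natCast_lt_top k⟩

/-- The boxes of upper half-lines form a generating π-system. -/
lemma ext_of_pi_Ici {ι : Type*} [Fintype ι] {μ₁ μ₂ : Measure (ι → ℝ≥0∞)}
    [IsProbabilityMeasure μ₁] [IsProbabilityMeasure μ₂]
    (h : ∀ t : ι → ℝ≥0∞, μ₁ (univ.pi fun i ↦ Ici (t i)) = μ₂ (univ.pi fun i ↦ Ici (t i))) :
    μ₁ = μ₂ := by
  refine ext_of_generate_finite (univ.pi '' univ.pi fun _ : ι ↦ range Ici) ?_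
    (IsPiSystem.pi fun _ ↦ isPiSystem_Ici) ?_ (by simp)
  · have hspan (_ : ι) : IsCountablySpanning (range (Ici : ℝ≥0∞ → Set ℝ≥0∞)) :=
      ⟨fun _ ↦ univ, fun _ ↦ ⟨0, by ext; simp⟩, iUnion_const _⟩
    have hborel : (inferInstance : MeasurableSpace ℝ≥0∞) =
        MeasurableSpace.generateFrom (range Ici) :=
      BorelSpace.measurable_eq.trans (borel_eq_generateFrom_Ici _)
    exact (congrArg (fun m ↦ @MeasurableSpace.pi ι _ fun _ ↦ m) hborel).trans
      (generateFrom_pi_eq hspan)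
  · rintro _ ⟨s, hs, rfl⟩
    choose t ht using fun i ↦ hs i (mem_univ i)
    obtain rfl : (fun i ↦ Ici (t i)) = s := funext ht
    exact h t

omit [IsProbabilityMeasure P] in
lemma measurable_threshold_catalog (hlam : Measurable (Function.uncurry lam))
    (hmodel : IsCatalogModel γ ν lam arrival mark R P) (s : ℝ) (F : Finset D) :
    Measurable fun (q : Ω × (F → ℝ≥0∞)) (d : F) ↦
      threshold (docMeasure lam (arrival d q.1, mark d q.1)) s (q.2 d) :=
  measurable_pi_lambda _ fun d ↦ by
    have hcat : Measurable fun ω ↦ (arrival d ω, mark d ω) :=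
      (hmodel.measurable_arrival d).prodMk (hmodel.measurable_mark d)
    have hpair : Measurable fun q : Ω × (F → ℝ≥0∞) ↦ ((arrival d q.1, mark d q.1), q.2 d) :=
      (hcat.comp measurable_fst).prodMk ((measurable_pi_apply d).comp measurable_snd)
    simpa only [Function.comp_def] using (measurable_threshold_docMeasure hlam s).comp hpair

/-- Given the catalog, the request times are independent, and distributed like the time at which
the cumulative intensity exceeds an independent exponential level. -/
lemma map_requestTime_eq (hlam : Measurable (Function.uncurry lam))
    (hmodel : IsCatalogModel γ ν lam arrival mark R P) (s : ℝ) (F : Finset D) :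
    P.map (fun ω (d : F) ↦ requestTime R s d ω) =
      (P.prod (Measure.pi fun _ : F ↦ expLaw)).map (fun q (d : F) ↦
        threshold (docMeasure lam (arrival d q.1, mark d q.1)) s (q.2 d)) := by
  classical
  have hT : Measurable fun ω (d : F) ↦ requestTime R s d ω := measurable_pi_lambda _ fun d ↦
    measurable_requestTime (fun d ↦ (hmodel.request_isPointProcess d).measurable) s d
  have hS := measurable_threshold_catalog hlam hmodel s F
  have h1 := Measure.isProbabilityMeasure_map (μ := P) hT.aemeasurable
  have h2 := Measure.isProbabilityMeasure_map
    (μ := P.prod (Measure.pi fun _ : F ↦ expLaw)) hS.aemeasurable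
  refine ext_of_pi_Ici fun t ↦ ?_
  have hbox : MeasurableSet (univ.pi fun d ↦ Ici (t d)) :=
    MeasurableSet.univ_pi fun d ↦ measurableSet_Ici
  rw [Measure.map_apply hT hbox, Measure.map_apply hS hbox, Measure.prod_apply (hS hbox)]
  let B : D → Set ℝ := fun d ↦ if h : d ∈ F then window s (t ⟨d, h⟩) else ∅
  have hB (d) : MeasurableSet (B d) := by
    simp only [B]; split_ifs
    exacts [measurableSet_window _ _, MeasurableSet.empty]
  have hBF (d : F) : B d = window s (t d) := by simp [B]
  -- A lower bound on a request time says that a window contains no request, so only void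
  -- probabilities are used.
  have hset : (fun ω (d : F) ↦ requestTime R s d ω) ⁻¹' (univ.pi fun d ↦ Ici (t d)) =
      {ω | ∀ d ∈ F, R d ω (B d) = (0 : ℕ)} := by
    ext ω
    simp only [mem_preimage, mem_univ_pi, mem_Ici, requestTime, le_threshold_iff, ← hBF,
      Nat.cast_zero, le_zero_iff, Subtype.forall, mem_ofPred_eq]
  rw [hset, measure_counts_eq hlam hmodel F hB fun _ ↦ 0]
  refine lintegral_congr fun ω ↦ ?_
  have hsec : Prod.mk ω ⁻¹' ((fun (q : Ω × (F → ℝ≥0∞)) (d : F) ↦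
      threshold (docMeasure lam (arrival d q.1, mark d q.1)) s (q.2 d)) ⁻¹'
        univ.pi fun d ↦ Ici (t d)) =
      univ.pi fun d : F ↦ Ici (docMeasure lam (arrival d ω, mark d ω) (B d)) := by
    ext e
    simp only [mem_preimage, mem_univ_pi, mem_Ici, le_threshold_iff, hBF]
  rw [hsec, Measure.pi_pi]
  simp only [expLaw_Ici, Nat.cast_zero, poissonLaw_zero]
  rw [← Finset.prod_coe_sort]

/-- In the exponential-level representation the levels are independent of the catalog and of each
other; Fubini integrates them out one document at a time. -/
lemma lintegral_prod_requestTime (hlam : Measurable (Function.uncurry lam))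
    (hmodel : IsCatalogModel γ ν lam arrival mark R P)
    (s : ℝ) (F : Finset D) {f : ℝ≥0∞ → ℝ≥0∞} (hf : Measurable f) :
    ∫⁻ ω, ∏ d ∈ F, f (requestTime R s d ω) ∂P =
      ∫⁻ ω, ∏ d ∈ F, requestMean lam s f (arrival d ω, mark d ω) ∂P := by
  have hT : Measurable fun ω (d : F) ↦ requestTime R s d ω := measurable_pi_lambda _ fun d ↦
    measurable_requestTime (fun d ↦ (hmodel.request_isPointProcess d).measurable) s d
  have hS := measurable_threshold_catalog hlam hmodel s F
  have hprod : Measurable fun x : F → ℝ≥0∞ ↦ ∏ d, f (x d) :=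
    Finset.measurable_prod _ fun d _ ↦ hf.comp (measurable_pi_apply d)
  have hmean := lintegral_map (μ := P) hprod hT
  rw [map_requestTime_eq hlam hmodel, lintegral_map hprod hS,
    lintegral_prod _ (by simpa only [Function.comp_def] using (hprod.comp hS).aemeasurable)] at hmean
  simp_rw [← Finset.prod_coe_sort F]
  rw [← hmean]
  refine lintegral_congr fun ω ↦ ?_
  have hg (d : F) : Measurable fun e ↦
      f (threshold (docMeasure lam (arrival d ω, mark d ω)) s e) :=
    hf.comp (measurable_threshold_level _ s)
  simpa only [requestMean] using lintegral_pi_prod (fun _ : F ↦ expLaw) hg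

end Model

/-- Finite partial sums converge along the net of finite subsets, and dominated convergence passes
to the limit. This reduces statements on the whole catalog to finitely many documents. -/
lemma lintegral_expNeg_tsum_congr {Ω D : Type*} [MeasurableSpace Ω] [Countable D] {P : Measure Ω}
    [IsFiniteMeasure P] {x y : D → Ω → ℝ≥0∞} (hx : ∀ d, Measurable (x d))
    (hy : ∀ d, Measurable (y d))
    (h : ∀ F : Finset D, ∫⁻ ω, ∏ d ∈ F, expNeg (x d ω) ∂P = ∫⁻ ω, ∏ d ∈ F, expNeg (y d ω) ∂P) :
    ∫⁻ ω, expNeg (∑' d, x d ω) ∂P = ∫⁻ ω, expNeg (∑' d, y d ω) ∂P := by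
  have hlim {z : D → Ω → ℝ≥0∞} (hz : ∀ d, Measurable (z d)) :
      Tendsto (fun F : Finset D ↦ ∫⁻ ω, ∏ d ∈ F, expNeg (z d ω) ∂P) atTop
        (𝓝 (∫⁻ ω, expNeg (∑' d, z d ω) ∂P)) := by
    simp_rw [← expNeg_sum]
    refine tendsto_lintegral_filter_of_dominated_convergence (fun _ ↦ 1)
      (Eventually.of_forall fun F ↦ ?_)
      (Eventually.of_forall fun F ↦ ae_of_all _ fun ω ↦ expNeg_le_one _) (by simp)
      (ae_of_all _ fun ω ↦ ?_)
    · exact measurable_expNeg.comp (Finset.measurable_sum _ fun d _ ↦ hz d)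
    · exact (continuous_expNeg.tendsto _).comp ENNReal.summable.hasSum
  have hlimx := hlim hx
  simp_rw [h] at hlimx
  exact tendsto_nhds_unique hlimx (hlim hy)

/-! ### Averaging over profiles and arrivals; the intensity of first requests. -/

section Model

variable {Ω D M : Type*} [MeasurableSpace Ω] [MeasurableSpace M]
  {P : Measure Ω} {ν : Measure M} {γ : ℝ≥0} {lam : M → ℝ → ℝ≥0} {τ : M → ℝ≥0}
  {arrival : D → Ω → ℝ} {mark : D → Ω → M} {R : D → Ω → Measure ℝ}
  [IsProbabilityMeasure P]

/-- Averaging over the independent profiles, given the arrival times. -/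
lemma lintegral_prod_mark (hmodel : IsCatalogModel γ ν lam arrival mark R P) (F : Finset D)
    {g : ℝ × M → ℝ≥0∞} (hg : Measurable g) :
    ∫⁻ ω, ∏ d ∈ F, g (arrival d ω, mark d ω) ∂P =
      ∫⁻ ω, ∏ d ∈ F, ∫⁻ m, g (arrival d ω, m) ∂ν ∂P := by
  have ha : Measurable fun ω d ↦ arrival d ω := measurable_pi_lambda _ hmodel.measurable_arrival
  have hm : Measurable fun ω d ↦ mark d ω := measurable_pi_lambda _ hmodel.measurable_mark
  have hG : Measurable fun q : (D → ℝ) × (D → M) ↦ ∏ d ∈ F, g (q.1 d, q.2 d) :=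
    Finset.measurable_prod _ fun d _ ↦ hg.comp
      (((measurable_pi_apply d).comp measurable_fst).prodMk
        ((measurable_pi_apply d).comp measurable_snd))
  -- The joint law of arrivals and profiles is a product, so the arrivals can be frozen while the
  -- profiles are integrated.
  have hlaw := (indepFun_iff_map_prod_eq_prod_map_map ha.aemeasurable hm.aemeasurable).1
    hmodel.arrival_mark_indep
  have := Measure.isProbabilityMeasure_map (μ := P) hm.aemeasurable
  have hmap := lintegral_map (μ := P) hG (ha.prodMk hm)
  rw [← hmap, hlaw, lintegral_prod _ hG.aemeasurable, lintegral_map hG.lintegral_prod_right' ha]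
  refine lintegral_congr fun ω ↦ ?_
  have hgd (d : D) : Measurable fun m ↦ g (arrival d ω, m) :=
    hg.comp (measurable_const.prodMk measurable_id)
  rw [lintegral_map (f := fun y : D → M ↦ ∏ d ∈ F, g (arrival d ω, y d))
    (Finset.measurable_prod _ fun d _ ↦ (hgd d).comp (measurable_pi_apply d)) hm]
  rw [lintegral_prod_eq_prod_lintegral_of_indepFun F (fun d ω' ↦ g (arrival d ω, mark d ω'))
    (hmodel.mark_indep.comp (fun d m ↦ g (arrival d ω, m)) hgd)
    fun d ↦ (hgd d).comp (hmodel.measurable_mark d)]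
  exact Finset.prod_congr rfl fun d _ ↦
    (hmodel.mark_hasLaw d).lintegral_comp (hgd d).aemeasurable

/-- The intensity measure of the process of first request times from time `0` on. -/
def requestIntensity (γ : ℝ≥0) (ν : Measure M) (lam : M → ℝ → ℝ≥0) : Measure ℝ≥0∞ :=
  ((((γ : ℝ≥0∞) • (volume : Measure ℝ)).prod ν).prod expLaw).map
    fun q ↦ threshold (docMeasure lam q.1) 0 q.2

lemma lintegral_requestIntensity [SFinite ν] (hlam : Measurable (Function.uncurry lam))
    {f : ℝ≥0∞ → ℝ≥0∞} (hf : Measurable f) :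
    ∫⁻ t, f t ∂requestIntensity γ ν lam =
      γ * ∫⁻ a, ∫⁻ m, requestMean lam 0 f (a, m) ∂ν := by
  have hT := measurable_threshold_docMeasure hlam 0
  have hc : Measurable fun q : (ℝ × M) × ℝ≥0∞ ↦ f (threshold (docMeasure lam q.1) 0 q.2) := by
    simpa only [Function.comp_def] using hf.comp hT
  rw [requestIntensity, lintegral_map hf hT, lintegral_prod _ hc.aemeasurable]
  have := lintegral_prod (μ := (γ : ℝ≥0∞) • (volume : Measure ℝ)) (ν := ν) _
    (measurable_requestMean hlam 0 hf).aemeasurable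
  rwa [lintegral_smul_measure] at this

/-- The Laplace functional of the process of first request times from time `s` on. -/
theorem lintegral_expNeg_requestTime [Countable D] [IsProbabilityMeasure ν]
    (hlam : Measurable (Function.uncurry lam))
    (hmodel : IsCatalogModel γ ν lam arrival mark R P)
    (s : ℝ) {φ : ℝ≥0∞ → ℝ≥0∞} (hφ : Measurable φ) :
    ∫⁻ ω, expNeg (∑' d, φ (requestTime R s d ω)) ∂P =
      expNeg (∫⁻ t, (1 - expNeg (φ t)) ∂requestIntensity γ ν lam) := by
  let f : ℝ≥0∞ → ℝ≥0∞ := fun t ↦ expNeg (φ t)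
  have hf : Measurable f := measurable_expNeg.comp hφ
  let h : ℝ → ℝ → ℝ≥0∞ := fun s a ↦ ∫⁻ m, requestMean lam s f (a, m) ∂ν
  have hmean_le (p : ℝ × M) : requestMean lam s f p ≤ 1 := by
    refine (lintegral_mono fun e ↦ expNeg_le_one _).trans ?_
    simp
  have h_le (a : ℝ) : h s a ≤ 1 := (lintegral_mono fun m ↦ hmean_le (a, m)).trans (by simp)
  have hh : Measurable (h s) := (measurable_requestMean hlam s hf).lintegral_prod_right'
  have hT (d) : Measurable (requestTime R s d) :=
    measurable_requestTime (fun d ↦ (hmodel.request_isPointProcess d).measurable) s d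
  have hψ : Measurable fun a ↦ negLog (h s a) := measurable_negLog.comp hh
  -- Each request time is replaced by a function of the arrival time alone, turning the sum into an
  -- integral against the arrival process.
  rw [lintegral_expNeg_tsum_congr (x := fun d ω ↦ φ (requestTime R s d ω))
    (y := fun d ω ↦ negLog (h s (arrival d ω)))
    (fun d ↦ hφ.comp (hT d)) (fun d ↦ hψ.comp (hmodel.measurable_arrival d))]
  · have hsum (ω) : ∑' d, negLog (h s (arrival d ω)) =
        ∫⁻ a, negLog (h s a) ∂Measure.sum fun d ↦ Measure.dirac (arrival d ω) := by
      rw [lintegral_sum_measure]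
      simp_rw [lintegral_dirac' _ hψ]
    simp_rw [hsum]
    rw [hmodel.arrival_poisson.lintegral_expNeg hψ,
      lintegral_requestIntensity hlam (f := fun t ↦ 1 - expNeg (φ t)) (measurable_const.sub hf), lintegral_smul_measure]
    simp_rw [expNeg_negLog (h_le _)]
    have hshift (a : ℝ) : 1 - h s a =
        ∫⁻ m, requestMean lam 0 (fun t ↦ 1 - f t) (a - s, m) ∂ν := by
      simp_rw [← requestMean_shift]
      have hsub (m : M) : requestMean lam s (fun t ↦ 1 - f t) (a, m) =
          1 - requestMean lam s f (a, m) := by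
        have hm : Measurable fun e ↦ f (threshold (docMeasure lam (a, m)) s e) :=
          hf.comp (measurable_threshold_level _ s)
        unfold requestMean
        rw [lintegral_sub hm ((hmean_le (a, m)).trans_lt ENNReal.one_lt_top).ne
          (ae_of_all _ fun e ↦ expNeg_le_one _)]
        simp
      simp_rw [hsub]
      rw [lintegral_sub (f := fun m ↦ 1) (g := fun m ↦ requestMean lam s f (a, m))
        ((measurable_requestMean hlam s hf).comp (measurable_const.prodMk measurable_id)) ((h_le a).trans_lt ENNReal.one_lt_top).ne
        (ae_of_all _ fun m ↦ hmean_le (a, m))]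
      simp [h]
    simp_rw [hshift]
    -- Translation invariance of Lebesgue measure removes `s`.
    rw [lintegral_sub_right_eq_self
      (fun a ↦ ∫⁻ m, requestMean lam 0 (fun t ↦ 1 - f t) (a, m) ∂ν) s]
    rfl
  · intro F
    simp_rw [expNeg_negLog (h_le _)]
    exact (lintegral_prod_requestTime hlam hmodel s F hf).trans
      (lintegral_prod_mark hmodel F (measurable_requestMean hlam s hf))

/-- The mean number of documents requested in `[0, t]`. -/
lemma requestIntensity_Iic [IsProbabilityMeasure ν] (hprofile : IsRequestProfile ν lam τ)
    (t : ℝ≥0) :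
    requestIntensity γ ν lam (Iic t) = meanFunction γ ν lam t := by
  have hlam := hprofile.measurable_intensity
  rw [← lintegral_indicator_one measurableSet_Iic, lintegral_requestIntensity hlam
    (measurable_one.indicator measurableSet_Iic), meanFunction]
  have hmean (a : ℝ) : ∫⁻ m, requestMean lam 0 ((Iic (t : ℝ≥0∞)).indicator 1) (a, m) ∂ν =
      ∫⁻ m, ENNReal.ofReal (1 - Real.exp (-∫ v in (0 : ℝ)..t, (lam m (v - a) : ℝ))) ∂ν := by
    refine lintegral_congr_ae ?_
    filter_upwards [hprofile.ae_finite_total] with m hm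
    have hfin : IsFiniteMeasure (docMeasure lam (a, m)) :=
      ⟨by rw [docMeasure_univ]; exact hm⟩
    have hset : MeasurableSet {e | threshold (docMeasure lam (a, m)) 0 e ≤ t} :=
      measurableSet_le (measurable_threshold_level _ 0) measurable_const
    have hlamm : Measurable fun v ↦ lam m (v - a) :=
      hlam.comp (measurable_const.prodMk (measurable_id.sub_const a))
    have h1 : requestMean lam 0 ((Iic (t : ℝ≥0∞)).indicator 1) (a, m) =
        expLaw {e | threshold (docMeasure lam (a, m)) 0 e ≤ t} := by
      rw [← lintegral_indicator_one hset]
      rfl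
    have h2 : docMeasure lam (a, m) (Icc 0 (0 + t)) =
        ENNReal.ofReal (∫ v in (0 : ℝ)..t, (lam m (v - a) : ℝ)) := by
      have hne : ∫⁻ v in Ioc (0 : ℝ) t, (lam m (v - a) : ℝ≥0∞) ≠ ∞ := by
        refine (lt_of_le_of_lt ?_ (measure_lt_top (docMeasure lam (a, m)) univ)).ne
        rw [docMeasure, withDensity_apply _ MeasurableSet.univ, Measure.restrict_univ]
        exact setLIntegral_le_lintegral _ _
      rw [zero_add, docMeasure, withDensity_apply _ measurableSet_Icc, ← restrict_Ioc_eq_restrict_Icc,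
        intervalIntegral.integral_of_le t.coe_nonneg,
        integral_eq_lintegral_of_nonneg_ae (ae_of_all _ fun v ↦ NNReal.coe_nonneg _)
          hlamm.coe_nnreal_real.aestronglyMeasurable]
      simp only [ENNReal.ofReal_coe_nnreal]
      rw [ENNReal.ofReal_toReal hne]
    have h3 : 0 ≤ ∫ v in (0 : ℝ)..t, (lam m (v - a) : ℝ) :=
      intervalIntegral.integral_nonneg t.coe_nonneg fun v _ ↦ NNReal.coe_nonneg _
    rw [h1, expLaw_threshold_le, h2, expNeg_of_ne_top ENNReal.ofReal_ne_top,
      ENNReal.toReal_ofReal h3, ENNReal.ofReal_sub _ (Real.exp_nonneg _), ENNReal.ofReal_one]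
  congr 1
  rw [← lintegral_indicator measurableSet_Iic]
  refine lintegral_congr fun a ↦ (hmean a).trans ?_
  by_cases ha : a ∈ Iic (t : ℝ)
  · rw [indicator_of_mem ha]
  · rw [indicator_of_notMem ha]
    -- A document arriving after `t` has negative age throughout `[0, t]`, where its intensity
    -- vanishes; hence the integral stops at `t`.
    have hzero (m : M) : ∫ v in (0 : ℝ)..t, (lam m (v - a) : ℝ) = 0 := by
      refine intervalIntegral.integral_zero_ae (ae_of_all _ fun v hv ↦ ?_)
      rw [uIoc_of_le t.coe_nonneg] at hv
      rw [hprofile.zero_outside_lifespan m (v - a) fun h ↦ ?_, NNReal.coe_zero]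
      exact ha (by linarith [h.1, hv.2] : a ≤ t)
    simp [hzero]

end Model

/-! ### From request times to the counting processes. -/

lemma measurableEmbedding_coe_ennreal : MeasurableEmbedding ((↑) : ℝ≥0 → ℝ≥0∞) :=
  ENNReal.isOpenEmbedding_coe.measurableEmbedding

lemma tsum_indicator_one_eq_encard {D : Type*} (A : Set D) :
    ∑' d, A.indicator (1 : D → ℝ≥0∞) d = A.encard := by
  rw [← tsum_subtype, ← ENNReal.tsum_set_one]
  rfl

lemma lintegral_comap_coe_nnreal (ρ : Measure ℝ≥0∞) {g : ℝ≥0∞ → ℝ≥0∞} (hg : g ∞ = 0) :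
    ∫⁻ x : ℝ≥0, g x ∂ρ.comap (↑) = ∫⁻ t, g t ∂ρ := by
  have he := measurableEmbedding_coe_ennreal
  rw [← he.lintegral_map, he.map_comap, ← lintegral_indicator he.measurableSet_range]
  refine lintegral_congr fun t ↦ ?_
  induction t with
  | top => simp [hg]
  | coe t => rw [indicator_of_mem (mem_range_self t)]

/-- The law of a random vector with values in `ℕ∞` is determined by its law in `[0, ∞]`. -/
lemma map_enat_eq_of_map_ennreal_eq {Ω ι : Type*} [MeasurableSpace Ω] [Finite ι] {P : Measure Ω}
    {X Y : Ω → ι → ℕ∞} (hX : Measurable X) (hY : Measurable Y)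
    (h : P.map (fun ω i ↦ (X ω i : ℝ≥0∞)) = P.map (fun ω i ↦ (Y ω i : ℝ≥0∞))) :
    P.map X = P.map Y := by
  let e : (ι → ℕ∞) → ι → ℝ≥0∞ := fun x i ↦ x i
  have hinj : Function.Injective e := fun x y hxy ↦
    funext fun i ↦ by simpa [e] using congrFun hxy i
  have he : Measurable e :=
    measurable_pi_lambda _ fun i ↦ Measurable.of_discrete.comp (measurable_pi_apply i)
  ext S hS
  -- As `ι` is finite, `ι → ℕ∞` is countable, so the image of every set is measurable.
  have hcount : MeasurableSet (e '' S) := ((Set.to_countable S).image _).measurableSet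
  have hS' : P.map (e ∘ X) (e '' S) = P.map (e ∘ Y) (e '' S) := congrArg (fun μ ↦ μ (e '' S)) h
  rwa [Measure.map_apply (he.comp hX) hcount, Measure.map_apply (he.comp hY) hcount,
    preimage_comp, preimage_comp, preimage_image_eq S hinj, ← Measure.map_apply hX hS,
    ← Measure.map_apply hY hS] at hS'

/-- The point process of the finite times between `0` and the first requests. -/
def requestProcess {Ω D : Type*} (R : D → Ω → Measure ℝ) (ω : Ω) : Measure ℝ≥0 :=
  (Measure.sum fun d ↦ Measure.dirac (requestTime R 0 d ω)).comap (↑)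

lemma requestProcess_apply {Ω D : Type*} (R : D → Ω → Measure ℝ) (ω : Ω) {B : Set ℝ≥0} (hB : MeasurableSet B) :
    requestProcess R ω B = ∑' d, ((↑) '' B : Set ℝ≥0∞).indicator 1 (requestTime R 0 d ω) := by
  have he := measurableEmbedding_coe_ennreal
  rw [requestProcess, he.comap_apply, Measure.sum_apply _ (he.measurableSet_image.2 hB)]
  simp_rw [Measure.dirac_apply' _ (he.measurableSet_image.2 hB)]

section Model

variable {Ω D M : Type*} [MeasurableSpace Ω] [MeasurableSpace M] [Countable D]
  {P : Measure Ω} {ν : Measure M} {γ : ℝ≥0} {lam : M → ℝ → ℝ≥0} {τ : M → ℝ≥0}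
  {arrival : D → Ω → ℝ} {mark : D → Ω → M} {R : D → Ω → Measure ℝ}

lemma measurable_distinctRequested (hR : ∀ d, Measurable (R d)) (s t : ℝ) :
    Measurable (distinctRequested R s t) := by
  have hcoe : Measurable fun ω ↦ (distinctRequested R s t ω : ℝ≥0∞) := by
    have (ω : Ω) : (distinctRequested R s t ω : ℝ≥0∞) =
        ∑' d, {ω | R d ω (Icc s t) ≠ 0}.indicator (1 : Ω → ℝ≥0∞) ω := by
      rw [distinctRequested, ← tsum_indicator_one_eq_encard]
      rfl
    simp_rw [this]
    refine Measurable.tsum fun d ↦ measurable_one.indicator ?_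
    exact ((Measure.measurable_coe measurableSet_Icc).comp (hR d)) (measurableSet_singleton 0).compl
  refine measurable_to_countable fun ω ↦ ?_
  have : distinctRequested R s t ⁻¹' {distinctRequested R s t ω} =
      (fun ω ↦ (distinctRequested R s t ω : ℝ≥0∞)) ⁻¹' {(distinctRequested R s t ω : ℝ≥0∞)} := by
    ext; simp
  rw [this]
  exact hcoe (measurableSet_singleton _)

variable [IsProbabilityMeasure P]

/-- Almost surely, the documents requested in `[s, s + t]` are those with request time at
most `t`. -/
lemma ae_distinctRequested_eq (hprofile : IsRequestProfile ν lam τ)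
    (hmodel : IsCatalogModel γ ν lam arrival mark R P) :
    ∀ᵐ ω ∂P, ∀ (s : ℝ) (t : ℝ≥0), (distinctRequested R s (s + t) ω : ℝ≥0∞) =
      ∑' d, (Iic (t : ℝ≥0∞)).indicator 1 (requestTime R s d ω) := by
  -- The exceptional event is that some request process is infinite; it depends on neither `s` nor
  -- `t`.
  filter_upwards [ae_isFiniteMeasure_request hprofile hmodel] with ω hω s t
  rw [distinctRequested, ← tsum_indicator_one_eq_encard]
  refine tsum_congr fun d ↦ ?_
  have := hω d
  have hiff := threshold_zero_le_iff ((hmodel.request_isPointProcess d).integer_valued ω) s t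
  by_cases h : R d ω (Icc s (s + t)) ≠ 0
  · rw [indicator_of_mem (show d ∈ {d | R d ω (Icc s (s + t)) ≠ 0} from h),
      indicator_of_mem (show requestTime R s d ω ∈ Iic (t : ℝ≥0∞) from hiff.2 h)]
    rfl
  · rw [indicator_of_notMem (show d ∉ {d | R d ω (Icc s (s + t)) ≠ 0} from h),
      indicator_of_notMem (show requestTime R s d ω ∉ Iic (t : ℝ≥0∞) from mt hiff.1 h)]

/-- The Laplace transform of the numbers of documents requested in `[s, s + u i]`, which does not
depend on `s`. -/
lemma lintegral_expNeg_distinctRequested [IsProbabilityMeasure ν]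
    (hprofile : IsRequestProfile ν lam τ)
    (hmodel : IsCatalogModel γ ν lam arrival mark R P) (s : ℝ) {ι : Type*} [Fintype ι]
    (u : ι → ℝ≥0) (k : ι → ℕ) :
    ∫⁻ ω, expNeg (∑ i, k i * (distinctRequested R s (s + u i) ω : ℝ≥0∞)) ∂P =
      expNeg (∫⁻ t, (1 - expNeg (∑ i, k i * (Iic (u i : ℝ≥0∞)).indicator 1 t))
        ∂requestIntensity γ ν lam) := by
  rw [← lintegral_expNeg_requestTime hprofile.measurable_intensity hmodel s
    (φ := fun t ↦ ∑ i, k i * (Iic (u i : ℝ≥0∞)).indicator 1 t)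
    (Finset.measurable_sum _ fun i _ ↦
      (measurable_one.indicator measurableSet_Iic).const_mul (k i : ℝ≥0∞))]
  refine lintegral_congr_ae ?_
  filter_upwards [ae_distinctRequested_eq hprofile hmodel] with ω hω
  rw [Summable.tsum_finsetSum fun i _ ↦ ENNReal.summable]
  simp_rw [hω, ENNReal.tsum_mul_left]

/-- The finite-dimensional distributions of `(X^s_{s + u})_{u ≥ 0}` do not depend on `s`. -/
lemma map_distinctRequested_eq [IsProbabilityMeasure ν] (hprofile : IsRequestProfile ν lam τ)
    (hmodel : IsCatalogModel γ ν lam arrival mark R P) (s s' : ℝ) {ι : Type*} [Fintype ι]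
    (u : ι → ℝ≥0) :
    P.map (fun ω i ↦ distinctRequested R s (s + u i) ω) =
      P.map (fun ω i ↦ distinctRequested R s' (s' + u i) ω) := by
  have hR := fun d ↦ (hmodel.request_isPointProcess d).measurable
  have hmeas (s : ℝ) : Measurable fun ω i ↦ distinctRequested R s (s + u i) ω :=
    measurable_pi_lambda _ fun i ↦ measurable_distinctRequested hR s _
  have hcoe (s : ℝ) : Measurable fun ω i ↦ (distinctRequested R s (s + u i) ω : ℝ≥0∞) :=
    measurable_pi_lambda _ fun i ↦
      Measurable.of_discrete.comp (measurable_distinctRequested hR s _)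
  refine map_enat_eq_of_map_ennreal_eq (hmeas s) (hmeas s') ?_
  have h1 := Measure.isProbabilityMeasure_map (μ := P) (hcoe s).aemeasurable
  have h2 := Measure.isProbabilityMeasure_map (μ := P) (hcoe s').aemeasurable
  refine ext_of_lintegral_expNeg fun k ↦ ?_
  have hm : Measurable fun x : ι → ℝ≥0∞ ↦ expNeg (∑ i, k i * x i) :=
    measurable_expNeg.comp (by fun_prop)
  rw [lintegral_map hm (hcoe s), lintegral_map hm (hcoe s'),
    lintegral_expNeg_distinctRequested hprofile hmodel s,
    lintegral_expNeg_distinctRequested hprofile hmodel s']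

lemma isPointProcess_requestProcess (hR : ∀ d, Measurable (R d)) :
    IsPointProcess (requestProcess R) := by
  refine ⟨Measure.measurable_of_measurable_coe _ fun B hB ↦ ?_, fun ω B hB ↦ ?_⟩
  · simp_rw [requestProcess_apply R _ hB]
    exact Measurable.tsum fun d ↦ (measurable_one.indicator
      (measurableEmbedding_coe_ennreal.measurableSet_image.2 hB)).comp
        (measurable_requestTime hR 0 d)
  · refine ⟨{d | requestTime R 0 d ω ∈ ((↑) '' B : Set ℝ≥0∞)}.encard, ?_⟩
    rw [requestProcess_apply R ω hB, ← tsum_indicator_one_eq_encard]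
    rfl

/-- The process of first requests is a Poisson point process. -/
theorem isPoissonPointProcess_requestProcess [IsProbabilityMeasure ν]
    (hprofile : IsRequestProfile ν lam τ)
    (hmodel : IsCatalogModel γ ν lam arrival mark R P) :
    IsPoissonPointProcess (requestProcess R) ((requestIntensity γ ν lam).comap (↑)) P := by
  refine isPoissonPointProcess_of_lintegral_expNeg
    (isPointProcess_requestProcess fun d ↦ (hmodel.request_isPointProcess d).measurable)
    fun φ hφ ↦ ?_
  -- Extending `φ` by `0` at `∞` ignores the documents that are never requested from time `0` on.
  let g : ℝ≥0∞ → ℝ≥0∞ := fun t ↦ if t = ∞ then 0 else φ t.toNNReal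
  have hg : Measurable g := Measurable.ite (measurableSet_singleton _) measurable_const
    (hφ.comp ENNReal.measurable_toNNReal)
  have hgφ (x : ℝ≥0) : φ x = g x := by simp [g]
  have hg0 : g ∞ = 0 := by simp [g]
  simp_rw [hgφ]
  rw [lintegral_comap_coe_nnreal _ (g := fun t ↦ 1 - expNeg (g t)) (by simp [hg0]),
    ← lintegral_expNeg_requestTime hprofile.measurable_intensity hmodel 0 hg]
  refine lintegral_congr fun ω ↦ ?_
  rw [requestProcess, lintegral_comap_coe_nnreal _ hg0, lintegral_sum_measure]
  simp_rw [lintegral_dirac' _ hg]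

lemma ae_distinctRequested_zero_eq (hprofile : IsRequestProfile ν lam τ)
    (hmodel : IsCatalogModel γ ν lam arrival mark R P) :
    ∀ᵐ ω ∂P, ∀ t : ℝ≥0, (distinctRequested R 0 (t : ℝ) ω : ℝ≥0∞) =
      requestProcess R ω (Iic t) := by
  filter_upwards [ae_distinctRequested_eq hprofile hmodel] with ω hω t
  have := hω 0 t
  rw [zero_add] at this
  rw [this, requestProcess_apply R ω measurableSet_Iic, ENNReal.image_coe_Iic]

lemma comap_requestIntensity_Iic [IsProbabilityMeasure ν] (hprofile : IsRequestProfile ν lam τ)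
    (t : ℝ≥0) :
    (requestIntensity γ ν lam).comap (↑) (Iic t) = meanFunction γ ν lam t := by
  rw [measurableEmbedding_coe_ennreal.comap_apply, ENNReal.image_coe_Iic,
    requestIntensity_Iic hprofile]

end Model

end

end CatalogModel

theorem proposition1 {Ω D M : Type*} [MeasurableSpace Ω] [Countable D] [MeasurableSpace M]
    (P : Measure Ω) [IsProbabilityMeasure P]
    (ν : Measure M) [IsProbabilityMeasure ν]
    (γ : ℝ≥0) (lam : M → ℝ → ℝ≥0) (τ : M → ℝ≥0)
    (arrival : D → Ω → ℝ) (mark : D → Ω → M) (R : D → Ω → Measure ℝ)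
    (hprofile : CatalogModel.IsRequestProfile ν lam τ)
    (hmodel : CatalogModel.IsCatalogModel γ ν lam arrival mark R P) :
    (∀ s : ℝ, 0 < s →
      IdentDistrib
        (fun ω (t : Set.Ici s) => CatalogModel.distinctRequested R s (t : ℝ) ω)
        (fun ω (t : Set.Ici s) => CatalogModel.distinctRequested R 0 ((t : ℝ) - s) ω) P P) ∧
    CatalogModel.IsPoissonProcess
      (fun t : ℝ≥0 => CatalogModel.distinctRequested R 0 (t : ℝ))
      (CatalogModel.meanFunction γ ν lam) P ∧
    (∀ t : ℝ≥0, ∫⁻ ω, (CatalogModel.distinctRequested R 0 (t : ℝ) ω : ℝ≥0∞) ∂P =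
      CatalogModel.meanFunction γ ν lam t) := by
  have hpoisson := CatalogModel.isPoissonPointProcess_requestProcess hprofile hmodel
  have hae := CatalogModel.ae_distinctRequested_zero_eq hprofile hmodel
  have hR := fun d ↦ (hmodel.request_isPointProcess d).measurable
  refine ⟨fun s _ ↦ ?_, ⟨_, _, hpoisson, CatalogModel.comap_requestIntensity_Iic hprofile, hae⟩,
    fun t ↦ ?_⟩
  · have hX : Measurable fun ω (t : Set.Ici s) ↦
        CatalogModel.distinctRequested R s (t : ℝ) ω :=
      measurable_pi_lambda _ fun t ↦ CatalogModel.measurable_distinctRequested hR s _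
    have hY : Measurable fun ω (t : Set.Ici s) ↦
        CatalogModel.distinctRequested R 0 ((t : ℝ) - s) ω :=
      measurable_pi_lambda _ fun t ↦ CatalogModel.measurable_distinctRequested hR 0 _
    refine ⟨hX.aemeasurable, hY.aemeasurable, ?_⟩
    -- The law on the path space is determined by its finite-dimensional distributions.
    refine (map_eq_iff_forall_finset_map_restrict_eq
      (X := fun (t : Set.Ici s) ω ↦ CatalogModel.distinctRequested R s (t : ℝ) ω)
      (Y := fun (t : Set.Ici s) ω ↦ CatalogModel.distinctRequested R 0 ((t : ℝ) - s) ω)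
      hX.aemeasurable hY.aemeasurable).2 fun I ↦ ?_
    have h := CatalogModel.map_distinctRequested_eq hprofile hmodel s 0
      (fun t : I ↦ (((t : Set.Ici s) : ℝ) - s).toNNReal)
    have hu (t : I) : ((((t : Set.Ici s) : ℝ) - s).toNNReal : ℝ) = ((t : Set.Ici s) : ℝ) - s :=
      Real.coe_toNNReal _ (sub_nonneg.2 (t : Set.Ici s).2)
    simp only [hu, add_sub_cancel, zero_add] at h
    exact h
  -- The mean of a Poisson variable is its parameter, also when that is `∞`.
  · rw [← CatalogModel.comap_requestIntensity_Iic hprofile,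
      ← CatalogModel.lintegral_id_poissonLaw (Measure.comap _ _ (Set.Iic t)),
      ← (hpoisson.hasLaw (Set.Iic t) measurableSet_Iic).lintegral_comp
        (f := fun x ↦ x) aemeasurable_id]
    exact MeasureTheory.lintegral_congr_ae (hae.mono fun ω hω ↦ hω t)
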